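/- Let $F_2$ be the free group with basis $\{a,b\}$, and let $\sigma,\tau$ be the automorphisms of $F_2$ given by $\sigma(a)=ab$, $\sigma(b)=b$ and $\tau(a)=a$, $\tau(b)=ba$. For $v\in F_2$ let $|v|$ be the length of the reduced word representing $v$, let $[v]$ be the cyclic word associated with $v$ (the class, under cyclic permutation, of the cyclically reduced words conjugate to $v$), and let the cyclic length $\|v\|$ be the length of $[v]$. For automorphisms $\phi,\phi'$ of $F_2$ write $\phi\equiv\phi'$ if $[\phi(w)]=[\phi'(w)]$ for all $w\in F_2$. A chain of type (C1) is an automorphism $\phi$ given, up to $\equiv$, by an expression $$\phi\equiv\tau^{m_r}\sigma^{l_r}\cdots\tau^{m_1}\sigma^{l_1},\qquad l_i,m_i\ge 0,$$ with automorphisms composed from right to left; its length is $|\phi|=\sum_{i=1}^r(m_i+l_i)$. Let $H=\langle u_1,\dots,u_k\rangle$ be a finitely generated subgroup of $F_2$, given by the generators $u_1,\dots,u_k$, and put $|H|=\max_{1\le i\le k}|u_i|$ (and $|H|=0$ if $k=0$). Suppose that $\phi$ is a chain of type (C1) with $|\phi|\ge 4|H|+5$ such that $\|\phi(u_i)\|=\|u_i\|$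 for every $i=1,\dots,k$. Then there exists a chain $\psi$ of type (C1) with $|\psi|<|\phi|$ such that $[\psi(u_i)]=[\phi(u_i)]$ for every $i=1,\dots,k$. -/

import Mathlib

/-- The free group `F₂`, with basis indexed by `Fin 2`. -/
abbrev F2 : Type := FreeGroup (Fin 2)

namespace F2

/-- The first basis element. -/
def a : F2 := FreeGroup.of 0

/-- The second basis element. -/
def b : F2 := FreeGroup.of 1

/-- The Whitehead automorphism `({a}, b)`: it sends `a` to `a * b` and fixes `b`. -/
def sigma : MulAut F2 :=
  MonoidHom.toMulEquiv (FreeGroup.lift ![a * b, b]) (FreeGroup.lift ![a * b⁻¹, b])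
    (by ext i; fin_cases i <;> simp [a, b]) (by ext i; fin_cases i <;> simp [a, b])

/-- The Whitehead automorphism `({b}, a)`: it fixes `a` and sends `b` to `b * a`. -/
def tau : MulAut F2 :=
  MonoidHom.toMulEquiv (FreeGroup.lift ![a, b * a]) (FreeGroup.lift ![a, b * a⁻¹])
    (by ext i; fin_cases i <;> simp [a, b]) (by ext i; fin_cases i <;> simp [a, b])

/-- The word length `|v|` of an element of `F₂` with respect to the basis `{a, b}`. -/
def wordLength (v : F2) : ℕ := v.norm

/-- The cyclic word `[v]`: the class, under cyclic permutation, of the cyclically reduced words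
conjugate to `v`. -/
def cyclicWord (v : F2) : Cycle (Fin 2 × Bool) :=
  (FreeGroup.reduceCyclically v.toWord : List (Fin 2 × Bool))

/-- The cyclic length `‖v‖`, that is, the length of the cyclic word `[v]`. -/
def cyclicLength (v : F2) : ℕ := (cyclicWord v).length

/-- `φ ≡ ψ`: the automorphisms `φ` and `ψ` agree on all cyclic words. -/
def CyclicEquiv (φ ψ : MulAut F2) : Prop :=
  ∀ w : F2, cyclicWord (φ w) = cyclicWord (ψ w)

/-- A (formal) chain of type (C1), `τ ^ m_k * σ ^ l_k * ⋯ * τ ^ m_1 * σ ^ l_1`, given by the list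
`[(l_1, m_1), …, (l_k, m_k)]` of its exponents. The exponents are natural numbers, and may be
zero. -/
abbrev ChainC1 : Type := List (ℕ × ℕ)

namespace ChainC1

/-- The automorphism `τ ^ m_k * σ ^ l_k * ⋯ * τ ^ m_1 * σ ^ l_1` (automorphisms are composed from
right to left, so that the block `τ ^ m_1 * σ ^ l_1` acts first). -/
def toAut : ChainC1 → MulAut F2
  | [] => 1
  | (l, m) :: c => toAut c * (tau ^ m * sigma ^ l)

/-- The length `∑ (m_i + l_i)` of a chain. -/
def len (c : ChainC1) : ℕ := (c.map fun p => p.2 + p.1).sum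

end ChainC1

/-- `|H| = max |u_i|` for the subgroup `H` given by the generating tuple `u_1, …, u_k`
(and `0` for the empty tuple). -/
def genLength {k : ℕ} (u : Fin k → F2) : ℕ := Finset.univ.sup fun i => wordLength (u i)

end F2

namespace F2

open FreeGroup List

/-! Regard a chain as a list of letters `sigma`, `tau` acting in turn, and follow the cyclic length
of each `u i`. Its change under a generator or an inverse generator is a sum of local terms over
cyclically adjacent letters (`Closed.cyclicLength_gen`). Adding the change under the next generator
to the change under the inverse of the previous one leaves a count of squares `xx`, so the length is
convex along the chain (`two_mul_cyclicLength_le`).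

These lengths are natural numbers that start at most at `L = |H|` and return to their initial value,
so they are constant away from the first and last `L` steps (`eq_of_convex`). If the generator
changes on this plateau, equality in the convexity estimate excludes squares and forces the step
just after the change to fix every conjugacy class involved (`isConj_gen_of_turn`). Otherwise one
generator is repeated at least `L + 1` times, and it fixes the classes because any nonzero drift of
exponents would by then make the words longer (`isConj_gen_of_run`). The position of this step
depends only on the list, so one deletion serves all `u i` at once. -/

/-- Letters of the alphabet `a, b, a⁻¹, b⁻¹`. -/
abbrev Letter : Type := Fin 2 × Bool

/-! ### Cyclic words as conjugacy invariants -/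

theorem reduceCyclically_eq_self {L : List Letter} (h : IsCyclicallyReduced L) :
    reduceCyclically L = L := by
  induction L using List.bidirectionalRec with
  | nil => simp
  | singleton x => simp
  | cons_append x l y _ =>
    rw [reduceCyclically.cons_append]
    have := (isCyclicallyReduced_cons_append_iff.1 h).2
    rw [if_neg]
    · simp
    · rintro ⟨h1, h2⟩
      have := this h1
      simp [this] at h2

theorem cyclicWord_mk {p : List Letter} (h : IsCyclicallyReduced p) :
    cyclicWord (FreeGroup.mk p) = (p : Cycle Letter) := by
  unfold cyclicWord
  rw [toWord_mk, h.isReduced.reduce_eq, reduceCyclically_eq_self h]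

theorem isCyclicallyReduced_of_append_singleton {x : Letter} {M : List Letter}
    (h : IsReduced (x :: (M ++ [x]))) : IsCyclicallyReduced (x :: M) := by
  refine ⟨IsReduced.infix h ⟨[], [x], by simp⟩, ?_⟩
  intro c hc d hd
  simp only [head?_cons, Option.mem_def, Option.some.injEq] at hd
  subst hd
  obtain ⟨N, hN⟩ : ∃ N, x :: M = N ++ [c] := by
    rw [Option.mem_def, getLast?_eq_some_iff] at hc; exact hc
  have h2 : IsReduced (N ++ [c] ++ [x]) := by rw [← hN]; simpa using h
  have h3 : IsReduced [c, x] := IsReduced.infix h2 ⟨N, [], by simp⟩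
  exact (isReduced_cons_cons.1 h3).1

theorem isCyclicallyReduced_append_singleton {x : Letter} {M : List Letter}
    (h : IsReduced (x :: (M ++ [x]))) : IsCyclicallyReduced (M ++ [x]) := by
  refine ⟨IsReduced.infix h ⟨[x], [], by simp⟩, ?_⟩
  intro c hc d hd
  simp only [getLast?_append, getLast?_singleton, Option.some_or, Option.mem_def,
    Option.some.injEq] at hc
  subst hc
  obtain ⟨N, hN⟩ : ∃ N, M ++ [x] = d :: N := by
    rw [Option.mem_def, head?_eq_some_iff] at hd; exact hd
  rw [hN] at h
  exact (isReduced_cons_cons.1 h).1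

theorem coe_append_singleton (x : Letter) (M : List Letter) :
    ((M ++ [x] : List Letter) : Cycle Letter) = ((x :: M : List Letter) : Cycle Letter) := by
  rw [Cycle.coe_eq_coe]
  exact ⟨M.length, by simp⟩

/-- Moving the first letter of a reduced word to its end does not change the cyclic word. -/
theorem cyclicWord_mk_cons_of_reduced {x : Letter} {M : List Letter} (h : IsReduced (x :: M)) :
    cyclicWord (FreeGroup.mk (x :: M)) = cyclicWord (FreeGroup.mk (M ++ [x])) := by
  by_cases hx : IsReduced (x :: (M ++ [x]))
  · rw [cyclicWord_mk (isCyclicallyReduced_of_append_singleton hx),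
      cyclicWord_mk (isCyclicallyReduced_append_singleton hx), coe_append_singleton]
  · rcases List.eq_nil_or_concat M with rfl | ⟨N, y, rfl⟩
    · simp
    -- Reducedness can only fail at the last junction, so `M` ends in the inverse of `x`. Cyclic
    -- reduction strips this pair from one side, free cancellation from the other.
    · have hy : y.1 = x.1 ∧ (!y.2) = x.2 := by
        by_contra hc
        apply hx
        have h2 : IsReduced [y, x] := by
          rw [isReduced_cons_cons]
          refine ⟨fun h1 => ?_, IsReduced.singleton⟩
          by_contra h2
          exact hc ⟨h1, by revert h2; cases y.2 <;> cases x.2 <;> simp⟩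
        have := IsReduced.append_overlap (L₁ := x :: N) (L₂ := [y]) (L₃ := [x])
          (by simpa using h) (by simpa using h2) (by simp)
        simpa using this
      have hyx : y = (x.1, !x.2) := by
        ext
        · simp [hy.1]
        · simp [← hy.2]
      have hN : IsReduced N := h.infix ⟨[x], [y], by simp⟩
      have e1 : FreeGroup.mk (N ++ [y] ++ [x]) = FreeGroup.mk N := by
        subst hyx
        rw [← mul_mk, ← mul_mk, mul_assoc]
        have : (FreeGroup.mk [(x.1, !x.2)] : F2) * FreeGroup.mk [x] = 1 := by
          rw [show (FreeGroup.mk [(x.1, !x.2)] : F2) = (FreeGroup.mk [x])⁻¹ by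
            rw [inv_mk]; simp [invRev], inv_mul_cancel]
        rw [this, mul_one]
      rw [List.concat_eq_append, e1]
      unfold cyclicWord
      rw [toWord_mk, toWord_mk, hN.reduce_eq]
      rw [List.concat_eq_append] at h
      rw [h.reduce_eq, reduceCyclically.cons_append, if_pos hy]

/-- If neither end cancels, cyclic reduction peels off the conjugating letter; if an end cancels,
the conjugate is a rotation of the word. -/
theorem cyclicWord_letter_conj (x : Letter) (v : F2) :
    cyclicWord (FreeGroup.mk [x] * v * (FreeGroup.mk [x])⁻¹) = cyclicWord v := by
  have hv : FreeGroup.mk v.toWord = v := mk_toWord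
  have hred : IsReduced v.toWord := isReduced_toWord
  by_cases hx : IsReduced (x :: v.toWord)
  · set w : F2 := FreeGroup.mk [x] * v * (FreeGroup.mk [x])⁻¹
    by_cases hx' : IsReduced (v.toWord ++ [(x.1, !x.2)])
    · rcases hM : v.toWord with _ | ⟨y, M⟩
      · have : v = 1 := toWord_eq_nil_iff.1 hM
        simp only [w, this]; rw [mul_one, mul_inv_cancel]
      have hr : IsReduced (x :: (v.toWord ++ [(x.1, !x.2)])) := by
        have := IsReduced.append_overlap (L₁ := [x]) (L₂ := v.toWord) (L₃ := [(x.1, !x.2)])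
          (by simpa using hx) hx' (by simp [hM])
        simpa using this
      have hw : w = FreeGroup.mk (x :: (v.toWord ++ [(x.1, !x.2)])) := by
        simp only [w]
        rw [← hv, inv_mk, mul_mk, mul_mk]; simp [invRev]
      unfold cyclicWord
      rw [hw, toWord_mk, hr.reduce_eq, reduceCyclically.cons_append]
      simp
    · rcases List.eq_nil_or_concat v.toWord with h0 | ⟨N, y, hN⟩
      · rw [h0] at hx'; simp at hx'
      rw [List.concat_eq_append] at hN
      have hyx : y = x := by
        by_contra hc
        apply hx'
        rw [hN]
        refine IsReduced.append_overlap (by simpa [hN] using hred) ?_ (by simp)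
        simp only [cons_append, nil_append, isReduced_cons_cons]
        refine ⟨fun h1 => ?_, IsReduced.singleton⟩
        by_contra h2
        apply hc
        ext
        · simp [h1]
        · revert h2; cases y.2 <;> cases x.2 <;> simp
      subst hyx
      have hw : w = FreeGroup.mk (y :: N) := by
        simp only [w]
        rw [← hv, hN, ← mul_mk (L₁ := N)]
        rw [mul_assoc, mul_inv_cancel_right, mul_mk]; simp
      rw [hw, cyclicWord_mk_cons_of_reduced, ← hN, hv]
      exact hx.infix ⟨[], [y], by simp [hN]⟩
  · rcases hM : v.toWord with _ | ⟨y, M⟩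
    · have : v = 1 := toWord_eq_nil_iff.1 hM
      rw [this, mul_one, mul_inv_cancel]
    have hyx : y = (x.1, !x.2) := by
      by_contra hc
      apply hx
      rw [hM, isReduced_cons_cons]
      refine ⟨fun h1 => ?_, hM ▸ hred⟩
      by_contra h2
      apply hc
      ext
      · simp [h1]
      · revert h2; cases y.2 <;> cases x.2 <;> simp
    have hi : (FreeGroup.mk [x])⁻¹ = (FreeGroup.mk [y] : F2) := by
      rw [inv_mk, hyx]; simp [invRev]
    have hv' : v = FreeGroup.mk [y] * FreeGroup.mk M := by
      rw [mul_mk, ← hv, hM]; simp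
    rw [hi]
    have : FreeGroup.mk [x] * v = FreeGroup.mk M := by
      rw [hv', ← hi]; group
    rw [this, hv', mul_mk, mul_mk]
    exact (cyclicWord_mk_cons_of_reduced (hM ▸ hred)).symm

theorem cyclicWord_conj (g v : F2) : cyclicWord (g * v * g⁻¹) = cyclicWord v := by
  have key : ∀ (L : List Letter) (v : F2),
      cyclicWord (FreeGroup.mk L * v * (FreeGroup.mk L)⁻¹) = cyclicWord v := by
    intro L
    induction L with
    | nil => intro v; simp [← one_eq_mk]
    | cons x L ih =>
      intro v
      have : (FreeGroup.mk (x :: L) : F2) = FreeGroup.mk [x] * FreeGroup.mk L := by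
        rw [mul_mk]; simp
      rw [this, ← ih v, ← cyclicWord_letter_conj x (FreeGroup.mk L * v * _)]
      congr 1
      group
  have := key g.toWord v
  rwa [mk_toWord] at this

theorem cyclicWord_eq_of_isConj {v w : F2} (h : IsConj v w) : cyclicWord v = cyclicWord w := by
  obtain ⟨g, rfl⟩ := isConj_iff.1 h
  exact (cyclicWord_conj g v).symm

theorem cyclicLength_eq_of_isConj {v w : F2} (h : IsConj v w) :
    cyclicLength v = cyclicLength w := by
  unfold cyclicLength; rw [cyclicWord_eq_of_isConj h]

theorem isConj_reduceCyclically (v : F2) :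
    IsConj v (FreeGroup.mk (reduceCyclically v.toWord)) := by
  have h := reduceCyclically.conj_conjugator_reduceCyclically v.toWord
  refine IsConj.symm (isConj_iff.2 ⟨FreeGroup.mk (reduceCyclically.conjugator v.toWord), ?_⟩)
  rw [inv_mk, mul_mk, mul_mk, h, mk_toWord]

theorem cyclicLength_le_wordLength (v : F2) : cyclicLength v ≤ wordLength v := by
  have h := congrArg List.length
    (reduceCyclically.conj_conjugator_reduceCyclically v.toWord)
  simp only [length_append] at h
  have : cyclicLength v = (reduceCyclically v.toWord).length := rfl
  rw [this]
  unfold wordLength FreeGroup.norm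
  omega

/-! ### Generators acting on syllable words -/

/-- The two generators of the monoid of chains: `gen 0 = sigma` and `gen 1 = tau`. -/
def gen : Fin 2 → MulAut F2 := ![sigma, tau]

/-- Addition in `Fin 2` makes `i + 1` the other index, so `sigma` and `tau` are treated together. -/
theorem gen_of (i : Fin 2) : gen i (of i) = of i * of (i + 1) := by
  fin_cases i <;> simp [gen, sigma, tau, a, b]

theorem gen_of_succ (i : Fin 2) : gen i (of (i + 1)) = of (i + 1) := by
  fin_cases i <;> simp [gen, sigma, tau, a, b]

theorem gen_zpow_of_succ (i : Fin 2) (j : ℤ) : (gen i ^ j) (of (i + 1)) = of (i + 1) := by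
  have h : gen i ∈ MulAction.stabilizer (MulAut F2) (of (i + 1) : F2) := gen_of_succ i
  exact zpow_mem h j

theorem gen_zpow_of (i : Fin 2) (j : ℤ) :
    (gen i ^ j) (of i) = of i * of (i + 1) ^ j := by
  induction j using Int.induction_on with
  | zero => simp
  | succ n ih =>
    rw [zpow_add, zpow_one, MulAut.mul_apply, gen_of, _root_.map_mul, ih, gen_zpow_of_succ, zpow_add,
      zpow_one, mul_assoc]
  | pred n ih =>
    have h1 : (gen i)⁻¹ (of i) = of i * (of (i + 1))⁻¹ := by
      rw [MulAut.inv_apply, MulEquiv.symm_apply_eq, _root_.map_mul, _root_.map_inv, gen_of, gen_of_succ]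
      group
    rw [zpow_sub, zpow_one, MulAut.mul_apply, h1, _root_.map_mul, _root_.map_inv, ih, gen_zpow_of_succ,
      zpow_sub, zpow_one, mul_assoc]

/-- The power `x ^ k` of the letter `x` with index `i + 1`, as a word. -/
def powWord (i : Fin 2) (k : ℤ) : List Letter := replicate k.natAbs (i + 1, decide (0 ≤ k))

/-- The word `x ^ k₁ * y ^ ε₁ * x ^ k₂ * y ^ ε₂ * ⋯` where `y` is the letter with index `i` and `x`
is the other one. -/
def syllWord (i : Fin 2) : List (ℤ × Bool) → List Letter
  | [] => []
  | (k, ε) :: s => powWord i k ++ (i, ε) :: syllWord i s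

/-- The amount by which `gen i` changes the exponent between two letters of index `i` with
signs `ε` and `ε'`. -/
def slope : Bool → Bool → ℤ
  | true, true => 1
  | false, false => -1
  | _, _ => 0

/-- The effect of `gen i ^ j` on a syllable list preceded by a letter of index `i` with
sign `ε`. -/
def shift (j : ℤ) : Bool → List (ℤ × Bool) → List (ℤ × Bool)
  | _, [] => []
  | ε, (k, ε') :: s => (k + j * slope ε ε', ε') :: shift j ε' s

/-- The syllable list, preceded by a letter of index `i` with sign `ε`, spells a reduced word. -/
def Valid : Bool → List (ℤ × Bool) → Prop
  | _, [] => True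
  | ε, (k, ε') :: s => (k = 0 → ε = ε') ∧ Valid ε' s

/-- The sign of the last letter of a syllable word preceded by a letter of sign `ε`. -/
def endSign : Bool → List (ℤ × Bool) → Bool
  | ε, [] => ε
  | _, (_, ε') :: s => endSign ε' s

theorem mk_powWord (i : Fin 2) (k : ℤ) :
    (FreeGroup.mk (powWord i k) : F2) = of (i + 1) ^ k := by
  have h : ∀ (x : Letter) (n : ℕ), (FreeGroup.mk (replicate n x) : F2) = FreeGroup.mk [x] ^ n := by
    intro x n
    induction n with
    | zero => simp [one_eq_mk]
    | succ n ih => rw [replicate_succ', ← mul_mk, ih, pow_succ]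
  unfold powWord
  rw [h]
  rcases le_or_gt 0 k with hk | hk
  · obtain ⟨n, rfl⟩ := Int.eq_ofNat_of_zero_le hk
    simp [FreeGroup.of]
  · obtain ⟨n, hn⟩ := Int.eq_ofNat_of_zero_le (show 0 ≤ -k by omega)
    obtain rfl : k = -n := by omega
    have : decide ((0 : ℤ) ≤ -n) = false := by simp; omega
    rw [this, Int.natAbs_neg, Int.natAbs_natCast, zpow_neg, zpow_natCast, ← inv_pow]
    congr 1

theorem endSign_shift (j : ℤ) (ε : Bool) (s : List (ℤ × Bool)) :
    endSign ε (shift j ε s) = endSign ε s := by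
  induction s generalizing ε with
  | nil => rfl
  | cons p s ih => exact ih p.2

/-- Between letters of opposite sign `slope` is zero, so no such exponent can become zero. -/
theorem valid_shift (j : ℤ) {ε : Bool} {s : List (ℤ × Bool)} (h : Valid ε s) :
    Valid ε (shift j ε s) := by
  induction s generalizing ε with
  | nil => trivial
  | cons p s ih =>
    obtain ⟨k, ε'⟩ := p
    refine ⟨fun h0 => ?_, ih h.2⟩
    have := h.1
    cases ε <;> cases ε' <;> simp_all [slope]

theorem getLast?_cons_syllWord (i : Fin 2) (ε : Bool) (s : List (ℤ × Bool)) :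
    ((i, ε) :: syllWord i s).getLast? = some (i, endSign ε s) := by
  induction s generalizing ε with
  | nil => rfl
  | cons p s ih =>
    obtain ⟨k, ε'⟩ := p
    rw [endSign, ← ih ε', syllWord, ← cons_append, getLast?_append,
      Option.or_of_isSome (by simp)]

theorem isReduced_cons_powWord_append {i : Fin 2} {ε ε' : Bool} {k : ℤ} {R : List Letter} :
    IsReduced ((i, ε) :: (powWord i k ++ (i, ε') :: R)) ↔
      (k = 0 → ε = ε') ∧ IsReduced ((i, ε') :: R) := by
  have hi : i + 1 ≠ i := by fin_cases i <;> decide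
  have h : ∀ (n : ℕ) (c : Bool), IsReduced (replicate n (i + 1, c) ++ (i, ε') :: R) ↔
      IsReduced ((i, ε') :: R) := by
    intro n c
    induction n with
    | zero => simp
    | succ n ih =>
      rw [replicate_succ, cons_append, ← ih]
      cases n with
      | zero => simp [isReduced_cons_cons, hi]
      | succ n => simp [replicate_succ, isReduced_cons_cons]
  rw [powWord]
  rcases hk : k.natAbs with _ | n
  · have : k = 0 := by omega
    simp [isReduced_cons_cons, this]
  · have : k ≠ 0 := by omega
    rw [← h (n + 1) (decide (0 ≤ k))]
    simp [replicate_succ, isReduced_cons_cons, this, hi.symm]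

theorem isReduced_cons_syllWord {i : Fin 2} {ε : Bool} {s : List (ℤ × Bool)} :
    IsReduced ((i, ε) :: syllWord i s) ↔ Valid ε s := by
  induction s generalizing ε with
  | nil => simp [syllWord, Valid]
  | cons p s ih => rw [syllWord, isReduced_cons_powWord_append, ih]; rfl

theorem exists_syllWord {i : Fin 2} {L : List Letter} {c : Bool} (h : IsReduced L)
    (hl : L.getLast? = some (i, c)) : ∃ k ε s, L = syllWord i ((k, ε) :: s) := by
  induction L with
  | nil => simp at hl
  | cons x L ih =>
    obtain ⟨m, e⟩ := x
    by_cases hm : m = i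
    · subst hm
      rcases L with _ | ⟨y, L⟩
      · exact ⟨0, e, [], by simp [syllWord, powWord]⟩
      · obtain ⟨k, ε, s, hs⟩ := ih (isReduced_cons_cons.1 h).2 (by simpa using hl)
        exact ⟨0, e, (k, ε) :: s, by rw [hs]; simp [syllWord, powWord]⟩
    · have hm' : m = i + 1 := by revert hm; fin_cases i <;> fin_cases m <;> simp
      subst hm'
      rcases L with _ | ⟨y, L⟩
      · simp at hl
      · obtain ⟨k, ε, s, hs⟩ := ih (isReduced_cons_cons.1 h).2 (by simpa using hl)
        rw [hs] at h ⊢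
        -- Reducedness forces the new letter to have the sign of the power it joins, so prepending
        -- it never cancels.
        have key : k ≠ 0 → e = decide (0 ≤ k) := by
          intro hk
          rcases hn : k.natAbs with _ | n
          · omega
          · simp only [syllWord, powWord, hn, replicate_succ, cons_append,
              isReduced_cons_cons] at h
            exact h.1 trivial
        refine ⟨if e then k + 1 else k - 1, ε, s, ?_⟩
        simp only [syllWord, powWord, ← cons_append]
        congr 1
        cases e
        · have hk : k ≤ 0 := by
            by_contra hc
            have := key (by omega)
            simp at this
            omega
          have e1 : (k - 1).natAbs = k.natAbs + 1 := by omega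
          have e2 : decide (0 ≤ k - 1) = false := by simp; omega
          simp only [Bool.false_eq_true, if_false]
          rw [e1, e2, replicate_succ]
          rcases eq_or_ne k 0 with rfl | h0
          · rfl
          · rw [← key h0]
        · have hk : 0 ≤ k := by
            by_contra hc
            have := key (by omega)
            simp at this
            omega
          have e1 : (k + 1).natAbs = k.natAbs + 1 := by omega
          have e2 : decide (0 ≤ k + 1) = true := by simp; omega
          have e3 : decide (0 ≤ k) = true := by simp; omega
          simp only [if_true]
          rw [e1, e2, e3, replicate_succ]

/-- The correction at a letter of index `i` and sign `ε` by which `gen i ^ j` fails to act on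
syllable words through `shift`. -/
def corr (i : Fin 2) (j : ℤ) (ε : Bool) : F2 := if ε then of (i + 1) ^ j else 1

/-- Writing `y` for the letter of index `i` and `x` for the other, `y` becomes `y x^j` and `y⁻¹`
becomes `x^(-j) y⁻¹`. The extra powers add up between equal signs and cancel or are absent between
opposite ones; only boundary terms remain. -/
theorem gen_zpow_syllWord (i : Fin 2) (j : ℤ) (ε : Bool) (s : List (ℤ × Bool)) :
    (gen i ^ j) (FreeGroup.mk (syllWord i s)) =
      (corr i j ε)⁻¹ * FreeGroup.mk (syllWord i (shift j ε s)) * corr i j (endSign ε s) := by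
  induction s generalizing ε with
  | nil => simp [syllWord, shift, endSign, ← one_eq_mk]
  | cons p s ih =>
    obtain ⟨k, ε'⟩ := p
    have e : ∀ (m : ℤ) (w : List Letter), (FreeGroup.mk (powWord i m ++ (i, ε') :: w) : F2) =
        of (i + 1) ^ m * FreeGroup.mk [(i, ε')] * FreeGroup.mk w := by
      intro m w
      rw [← mk_powWord, mul_mk, mul_mk]; simp
    rw [syllWord, shift, syllWord, e, e, _root_.map_mul, _root_.map_mul, _root_.map_zpow, gen_zpow_of_succ, ih ε',
      endSign]
    have hf : (FreeGroup.mk [(i, false)] : F2) = (of i)⁻¹ := rfl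
    have ht : (FreeGroup.mk [(i, true)] : F2) = of i := rfl
    cases ε <;> cases ε' <;> simp only [hf, ht, _root_.map_inv, gen_zpow_of, corr, slope] <;>
      simp <;> group

/-! ### Closed paths and sums over adjacent letters -/

/-- A closed reduced path: a reduced word whose first letter `x` is repeated at its end. The
word `t` is then cyclically reduced. -/
def Closed (x : Letter) (t : List Letter) : Prop := IsReduced (x :: t) ∧ t.getLast? = some x

theorem Closed.isCyclicallyReduced {x : Letter} {t : List Letter} (h : Closed x t) :
    IsCyclicallyReduced t := by
  obtain ⟨M, rfl⟩ := getLast?_eq_some_iff.1 h.2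
  exact isCyclicallyReduced_append_singleton h.1

theorem Closed.cyclicLength {x : Letter} {t : List Letter} (h : Closed x t) :
    F2.cyclicLength (FreeGroup.mk t) = t.length := by
  unfold F2.cyclicLength
  rw [cyclicWord_mk h.isCyclicallyReduced, Cycle.length_coe]

theorem exists_closed {v : F2} (hv : ¬ IsConj v 1) :
    ∃ x t, Closed x t ∧ IsConj v (FreeGroup.mk t) := by
  have h := isConj_reduceCyclically v
  have hr := reduceCyclically.isCyclicallyReduced (isReduced_toWord (x := v))
  set t := reduceCyclically v.toWord
  rcases List.eq_nil_or_concat t with h0 | ⟨M, x, hM⟩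
  · rw [h0, ← one_eq_mk] at h; exact absurd h hv
  · refine ⟨x, t, ⟨?_, by simp [hM]⟩, h⟩
    rcases ht : t with _ | ⟨y, N⟩
    · simp
    · rw [isReduced_cons_cons]
      exact ⟨hr.2 x (by simp [hM]) y (by simp [ht]), ht ▸ hr.1⟩

theorem Closed.rotate {x y : Letter} {l₁ l₂ : List Letter} (h : Closed x (l₁ ++ y :: l₂)) :
    Closed y (l₂ ++ l₁ ++ [y]) := by
  refine ⟨?_, by simp⟩
  rcases List.eq_nil_or_concat l₂ with rfl | ⟨N, z, rfl⟩
  · obtain ⟨h1, h2⟩ := h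
    simp at h2
    simpa [h2] using h1
  · obtain ⟨h1, h2⟩ := h
    obtain rfl : z = x := by
      simpa [getLast?_append, getLast?_cons, getLast?_concat] using h2
    have e1 : IsReduced ((y :: N) ++ [z]) := h1.infix ⟨z :: l₁, [], by simp⟩
    have e2 : IsReduced ([z] ++ (l₁ ++ [y])) := h1.infix ⟨[], N ++ [z], by simp⟩
    simpa using IsReduced.append_overlap e1 e2 (by simp)

theorem isConj_rotate (y : Letter) (l₁ l₂ : List Letter) :
    IsConj (FreeGroup.mk (l₁ ++ y :: l₂) : F2) (FreeGroup.mk (l₂ ++ l₁ ++ [y])) := by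
  refine IsConj.symm (isConj_iff.2 ⟨FreeGroup.mk (l₁ ++ [y]), ?_⟩)
  have : l₁ ++ y :: l₂ = (l₁ ++ [y]) ++ l₂ := by simp
  rw [this, append_assoc, ← mul_mk (L₁ := l₂), ← mul_mk (L₂ := l₂)]
  group

/-- The sum of `f` over the pairs of consecutive letters of a word. -/
def pairSum (f : Letter → Letter → ℤ) : List Letter → ℤ
  | [] => 0
  | [_] => 0
  | x :: y :: t => f x y + pairSum f (y :: t)

theorem pairSum_append (f : Letter → Letter → ℤ) (l r : List Letter) (y : Letter) :
    pairSum f (l ++ y :: r) = pairSum f (l ++ [y]) + pairSum f (y :: r) := by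
  induction l with
  | nil => simp [pairSum]
  | cons x l ih =>
    rcases l with _ | ⟨z, l⟩
    · simp [pairSum]
    · simp only [cons_append, pairSum] at ih ⊢
      rw [ih, add_assoc]

theorem pairSum_add (f g : Letter → Letter → ℤ) (l : List Letter) :
    pairSum (fun x y => f x y + g x y) l = pairSum f l + pairSum g l := by
  induction l with
  | nil => simp [pairSum]
  | cons x l ih =>
    rcases l with _ | ⟨z, l⟩
    · simp [pairSum]
    · simp only [pairSum] at ih ⊢
      rw [ih]; ring

theorem pairSum_nonneg {f : Letter → Letter → ℤ} (hf : ∀ x y, 0 ≤ f x y) (l : List Letter) :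
    0 ≤ pairSum f l := by
  induction l with
  | nil => simp [pairSum]
  | cons x l ih =>
    rcases l with _ | ⟨z, l⟩
    · simp [pairSum]
    · simp only [pairSum] at ih ⊢
      have := hf x z
      omega

/-- If `f` and `g` differ by the coboundary of `P` on the non-cancelling pairs, then so do their sums
over a reduced word. -/
theorem pairSum_congr {f g : Letter → Letter → ℤ} (P : Letter → ℤ)
    (h : ∀ x y : Letter, (x.1 = y.1 → x.2 = y.2) → f x y + P y = g x y + P x)
    {x z : Letter} {t : List Letter} (ht : IsReduced (x :: t)) (hz : (x :: t).getLast? = some z) :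
    pairSum f (x :: t) + P z = pairSum g (x :: t) + P x := by
  induction t generalizing x with
  | nil => simp at hz; simp [pairSum, hz]
  | cons y t ih =>
    rw [isReduced_cons_cons] at ht
    have h1 := ih ht.2 (by simpa using hz)
    have h2 := h x y ht.1
    simp only [pairSum]
    omega

/-- A coboundary telescopes to zero around a closed path, so an identity of cyclic sums reduces to a
finite check on pairs of letters. -/
theorem pairSum_congr_of_closed {f g : Letter → Letter → ℤ} (P : Letter → ℤ)
    (h : ∀ x y : Letter, (x.1 = y.1 → x.2 = y.2) → f x y + P y = g x y + P x)
    {x : Letter} {t : List Letter} (ht : Closed x t) :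
    pairSum f (x :: t) = pairSum g (x :: t) := by
  have hz : (x :: t).getLast? = some x := by
    rw [getLast?_cons, ht.2]; rfl
  have := pairSum_congr P h ht.1 hz
  omega

/-- With the last letter repeated in front, the sum meets each cyclically adjacent pair exactly
once. -/
theorem Closed.pairSum_rotate {x y : Letter} {l₁ l₂ : List Letter} (h : Closed x (l₁ ++ y :: l₂))
    (f : Letter → Letter → ℤ) :
    pairSum f (x :: (l₁ ++ y :: l₂)) = pairSum f (y :: (l₂ ++ l₁ ++ [y])) := by
  rw [← cons_append, pairSum_append]
  rcases List.eq_nil_or_concat l₂ with rfl | ⟨N, z, rfl⟩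
  · obtain ⟨h1, h2⟩ := h
    simp at h2
    simp [h2, pairSum]
  · obtain ⟨h1, h2⟩ := h
    obtain rfl : z = x := by
      simpa [getLast?_append, getLast?_cons, getLast?_concat] using h2
    have := pairSum_append f (y :: N) (l₁ ++ [y]) z
    simp only [concat_eq_append, cons_append, append_assoc, nil_append] at this ⊢
    rw [this, add_comm]

/-- A closed path either avoids the letters of index `i`, or can be rotated to a syllable word. -/
theorem Closed.forall_or_exists_syllWord {x : Letter} {t : List Letter} (h : Closed x t)
    (i : Fin 2) : (∀ y ∈ x :: t, y.1 = i + 1) ∨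
      ∃ ε s, Closed (i, ε) (syllWord i s) ∧ IsConj (FreeGroup.mk t : F2) (.mk (syllWord i s)) ∧
        (syllWord i s).length = t.length ∧
        ∀ f, pairSum f (x :: t) = pairSum f ((i, ε) :: syllWord i s) := by
  by_cases hc : ∃ y ∈ t, y.1 = i
  · right
    obtain ⟨⟨_, ε⟩, hy, rfl⟩ := hc
    obtain ⟨l₁, l₂, rfl⟩ := append_of_mem hy
    have hr := h.rotate
    obtain ⟨k, ε', s, hs⟩ := exists_syllWord (i := _) hr.isCyclicallyReduced.isReduced hr.2
    refine ⟨ε, (k, ε') :: s, hs ▸ hr, hs ▸ isConj_rotate _ l₁ l₂, ?_, fun f => ?_⟩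
    · rw [← hs]; simp; omega
    · rw [← hs, h.pairSum_rotate]
  · left
    have hx : x ∈ t := mem_of_getLast? h.2
    push Not at hc
    have : ∀ m : Fin 2, m ≠ i → m = i + 1 := by
      intro m; fin_cases i <;> fin_cases m <;> simp
    intro y hy
    rcases mem_cons.1 hy with rfl | hy
    · exact this _ (hc _ hx)
    · exact this _ (hc _ hy)

/-! ### The change of length as a local sum -/

/-- The sum of `f` over the pairs of consecutive letters of `y ^ ε * x ^ k * y ^ ε'`. -/
def gapSum (i : Fin 2) (f : Letter → Letter → ℤ) (ε : Bool) (k : ℤ) (ε' : Bool) : ℤ :=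
  if k = 0 then f (i, ε) (i, ε') else
    f (i, ε) (i + 1, decide (0 ≤ k)) + (|k| - 1) * f (i + 1, decide (0 ≤ k)) (i + 1, decide (0 ≤ k))
      + f (i + 1, decide (0 ≤ k)) (i, ε')

theorem pairSum_syllWord_cons (i : Fin 2) (f : Letter → Letter → ℤ) (ε ε' : Bool) (k : ℤ)
    (s : List (ℤ × Bool)) :
    pairSum f ((i, ε) :: syllWord i ((k, ε') :: s)) =
      gapSum i f ε k ε' + pairSum f ((i, ε') :: syllWord i s) := by
  have h : ∀ (n : ℕ) (y : Letter) (R : List Letter),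
      pairSum f (replicate (n + 1) y ++ (i, ε') :: R) =
        n * f y y + f y (i, ε') + pairSum f ((i, ε') :: R) := by
    intro n y R
    induction n with
    | zero => simp [pairSum]
    | succ n ih =>
      rw [replicate_succ, replicate_succ, cons_append, cons_append, pairSum, ← cons_append,
        ← replicate_succ, ih]
      push_cast; ring
  rw [syllWord, powWord, gapSum]
  rcases hk : k.natAbs with _ | n
  · have : k = 0 := by omega
    simp [this, pairSum]
  · have h0 : k ≠ 0 := by omega
    have h1 : |k| = n + 1 := by rw [Int.abs_eq_natAbs, hk]; rfl
    rw [if_neg h0, h1, replicate_succ, cons_append, pairSum, ← cons_append, ← replicate_succ, h]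
    ring

theorem length_syllWord_cons (i : Fin 2) (k : ℤ) (ε : Bool) (s : List (ℤ × Bool)) :
    ((syllWord i ((k, ε) :: s)).length : ℤ) = |k| + 1 + (syllWord i s).length := by
  rw [syllWord, powWord, Int.abs_eq_natAbs]
  simp
  ring

/-- The contribution of a pair of consecutive letters to the change of the cyclic length under
`gen i` (if `c` is true) or its inverse (if `c` is false). -/
def incr (i : Fin 2) (c : Bool) (x y : Letter) : ℤ :=
  if x.1 = i then (if y.1 = i ∨ (x.2 == y.2) = c then 1 else 0)
  else (if y.1 = i ∧ (x.2 == y.2) = !c then -1 else 0)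

/-- For `k ≠ 0` the pair entering the power contributes 0 or 1, the pair leaving it 0 or -1, and
inner pairs nothing. For `k = 0` the single pair contributes 1; the hypothesis excludes cancelling
neighbours there. -/
theorem gapSum_incr (i : Fin 2) (c : Bool) (ε ε' : Bool) (k : ℤ) (h : k = 0 → ε = ε') :
    gapSum i (incr i c) ε k ε' = |k + (if c then 1 else -1) * slope ε ε'| - |k| := by
  have hi : i + 1 ≠ i := by fin_cases i <;> decide
  unfold gapSum
  rcases lt_trichotomy k 0 with hk | rfl | hk
  · have : ¬ 0 ≤ k := by omega
    have h0 : |k| = -k := abs_of_neg hk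
    have h1 : |k + 1| = -(k + 1) := abs_of_nonpos (by omega)
    have h2 : |k + -1| = -(k + -1) := abs_of_neg (by omega)
    cases c <;> cases ε <;> cases ε' <;> simp [incr, hi, slope, hk.ne, this] <;> omega
  · obtain rfl := h rfl
    cases c <;> cases ε <;> simp [incr, slope]
  · have : 0 ≤ k := by omega
    have h0 : |k| = k := abs_of_pos hk
    have h1 : |k + 1| = k + 1 := abs_of_pos (by omega)
    have h2 : |k + -1| = k + -1 := abs_of_nonneg (by omega)
    cases c <;> cases ε <;> cases ε' <;> simp [incr, hi, slope, hk.ne', this] <;> omega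

theorem length_syllWord_shift (i : Fin 2) (c : Bool) {ε : Bool} {s : List (ℤ × Bool)}
    (h : Valid ε s) :
    ((syllWord i (shift (if c then 1 else -1) ε s)).length : ℤ) =
      (syllWord i s).length + pairSum (incr i c) ((i, ε) :: syllWord i s) := by
  induction s generalizing ε with
  | nil => simp [shift, syllWord, pairSum]
  | cons p s ih =>
    obtain ⟨k, ε'⟩ := p
    rw [shift, length_syllWord_cons, length_syllWord_cons, pairSum_syllWord_cons,
      gapSum_incr _ _ _ _ _ h.1, ih h.2]
    ring

theorem Closed.shift {i : Fin 2} {ε : Bool} {s : List (ℤ × Bool)}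
    (h : Closed (i, ε) (syllWord i s)) (j : ℤ) :
    Closed (i, ε) (syllWord i (shift j ε s)) := by
  refine ⟨isReduced_cons_syllWord.2 (valid_shift j (isReduced_cons_syllWord.1 h.1)), ?_⟩
  rcases s with _ | ⟨⟨k, ε'⟩, s⟩
  · simpa [syllWord] using h.2
  · have := h.2
    simp only [F2.shift, syllWord] at this ⊢
    rw [getLast?_append, Option.or_of_isSome (by simp), getLast?_cons_syllWord] at this ⊢
    rw [endSign_shift, this]

theorem Closed.endSign_eq {i : Fin 2} {ε : Bool} {s : List (ℤ × Bool)}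
    (h : Closed (i, ε) (syllWord i s)) : endSign ε s = ε := by
  have h1 := getLast?_cons_syllWord i ε s
  rw [getLast?_cons, h.2] at h1
  simpa using h1.symm

/-- On a closed path both boundary corrections have the same sign argument, hence amount to a
conjugation. -/
theorem Closed.isConj_gen_zpow {i : Fin 2} {ε : Bool} {s : List (ℤ × Bool)}
    (h : Closed (i, ε) (syllWord i s)) (j : ℤ) :
    IsConj ((gen i ^ j) (FreeGroup.mk (syllWord i s)))
      (FreeGroup.mk (syllWord i (F2.shift j ε s))) := by
  rw [gen_zpow_syllWord i j ε, h.endSign_eq]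
  refine isConj_iff.2 ⟨corr i j ε, ?_⟩
  group

theorem gen_zpow_eq_self {i : Fin 2} {t : List Letter} (h : ∀ y ∈ t, y.1 = i + 1) (j : ℤ) :
    (gen i ^ j) (FreeGroup.mk t) = FreeGroup.mk t := by
  induction t with
  | nil => rw [← one_eq_mk, _root_.map_one]
  | cons y t ih =>
    have e : (FreeGroup.mk (y :: t) : F2) = FreeGroup.mk [y] * FreeGroup.mk t := by
      rw [mul_mk]; rfl
    rw [e, _root_.map_mul, ih fun z hz => h z (mem_cons_of_mem _ hz)]
    congr 1
    obtain ⟨m, c⟩ := y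
    obtain rfl : m = i + 1 := h _ mem_cons_self
    have hf : (FreeGroup.mk [(i + 1, false)] : F2) = (of (i + 1))⁻¹ := rfl
    have ht : (FreeGroup.mk [(i + 1, true)] : F2) = of (i + 1) := rfl
    cases c <;> simp only [hf, ht, _root_.map_inv, gen_zpow_of_succ]

theorem pairSum_incr_eq_zero {i : Fin 2} {t : List Letter} (h : ∀ y ∈ t, y.1 = i + 1) (c : Bool) :
    pairSum (incr i c) t = 0 := by
  have hi : i + 1 ≠ i := by fin_cases i <;> decide
  induction t with
  | nil => rfl
  | cons x t ih =>
    rcases t with _ | ⟨y, t⟩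
    · rfl
    · rw [pairSum, ih fun z hz => h z (mem_cons_of_mem _ hz), incr,
        h x (by simp), h y (by simp)]
      simp [hi]

theorem isConj_map (φ : MulAut F2) {v w : F2} (h : IsConj v w) : IsConj (φ v) (φ w) := by
  obtain ⟨g, rfl⟩ := isConj_iff.1 h
  exact isConj_iff.2 ⟨φ g, by simp⟩

/-- The change of the cyclic length under a generator or its inverse. -/
theorem Closed.cyclicLength_gen {x : Letter} {t : List Letter} (h : Closed x t) (i : Fin 2)
    (c : Bool) :
    (F2.cyclicLength ((gen i ^ (if c then 1 else -1 : ℤ)) (FreeGroup.mk t)) : ℤ) =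
      t.length + pairSum (incr i c) (x :: t) := by
  rcases h.forall_or_exists_syllWord i with h0 | ⟨ε, s, hs, hconj, hlen, hsum⟩
  · rw [gen_zpow_eq_self fun y hy => h0 y (mem_cons_of_mem _ hy), pairSum_incr_eq_zero h0,
      h.cyclicLength, add_zero]
  · rw [cyclicLength_eq_of_isConj ((isConj_map _ hconj).trans (hs.isConj_gen_zpow _)),
      (hs.shift _).cyclicLength, length_syllWord_shift i c (isReduced_cons_syllWord.1 hs.1),
      hlen, hsum]

/-! ### Squares and convexity -/

/-- Indicator of a pair of equal consecutive letters of index `i`. -/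
def squarePair (i : Fin 2) (x y : Letter) : ℤ := if x = y ∧ x.1 = i then 1 else 0

theorem pairSum_squarePair_nonneg (i : Fin 2) (t : List Letter) :
    0 ≤ pairSum (squarePair i) t :=
  pairSum_nonneg (fun x y => by unfold squarePair; split <;> norm_num) t

theorem Closed.cyclicLength_gen_add_inv_same {x : Letter} {t : List Letter} (h : Closed x t)
    (i : Fin 2) :
    (F2.cyclicLength (gen i (.mk t)) + F2.cyclicLength ((gen i)⁻¹ (.mk t)) : ℤ) =
      2 * t.length + 2 * pairSum (squarePair i) (x :: t) := by
  have h1 := h.cyclicLength_gen i true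
  have h2 := h.cyclicLength_gen i false
  have h3 := pairSum_congr_of_closed (f := fun x y => incr i true x y + incr i false x y)
    -- The summed increments are 1 when leaving index `i` and -1 when entering it; the indicator of
    -- index `i` is the potential absorbing these.
    (g := fun x y => squarePair i x y + squarePair i x y) (fun x => if x.1 = i then 1 else 0)
    (by clear h1 h2; revert i; unfold incr squarePair; decide) h
  rw [pairSum_add, pairSum_add] at h3
  simp only [if_true, zpow_one, Bool.false_eq_true, if_false, zpow_neg] at h1 h2
  rw [h1, h2]
  linarith

/-- On mixed pairs the two increments cancel exactly, so no potential is needed; each square is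
counted once. -/
theorem Closed.cyclicLength_gen_add_inv_of_ne {x : Letter} {t : List Letter} (h : Closed x t)
    {i j : Fin 2} (hij : i ≠ j) :
    (F2.cyclicLength (gen j (.mk t)) + F2.cyclicLength ((gen i)⁻¹ (.mk t)) : ℤ) =
      2 * t.length + (pairSum (squarePair i) (x :: t) + pairSum (squarePair j) (x :: t)) := by
  have h1 := h.cyclicLength_gen j true
  have h2 := h.cyclicLength_gen i false
  have h3 := pairSum_congr_of_closed (f := fun x y => incr j true x y + incr i false x y)
    (g := fun x y => squarePair i x y + squarePair j x y) (fun _ => 0)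
    (by clear h1 h2; revert i j; unfold incr squarePair; decide) h
  rw [pairSum_add, pairSum_add] at h3
  simp only [if_true, zpow_one, Bool.false_eq_true, if_false, zpow_neg] at h1 h2
  rw [h1, h2]
  linarith

theorem isConj_map_one (φ : MulAut F2) {v : F2} (h : IsConj v 1) : IsConj (φ v) 1 := by
  simpa using isConj_map φ h

/-- Convexity of the cyclic length along chains. -/
theorem two_mul_cyclicLength_le (i j : Fin 2) (v : F2) :
    2 * cyclicLength (gen i v) ≤ cyclicLength (gen j (gen i v)) + cyclicLength v := by
  by_cases hv : IsConj (gen i v) 1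
  · rw [cyclicLength_eq_of_isConj hv]
    have : cyclicLength 1 = 0 := by simp [cyclicLength, cyclicWord]
    omega
  · obtain ⟨x, t, ht, hc⟩ := exists_closed hv
    -- The base point is the middle word: `v` lies one inverse step before it.
    have e1 : cyclicLength v = cyclicLength ((gen i)⁻¹ (.mk t)) := by
      rw [← cyclicLength_eq_of_isConj (isConj_map _ hc), MulAut.inv_apply_self]
    rw [e1, cyclicLength_eq_of_isConj hc, cyclicLength_eq_of_isConj (isConj_map _ hc),
      ht.cyclicLength]
    by_cases hij : i = j
    · subst hij
      have := ht.cyclicLength_gen_add_inv_same i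
      have := pairSum_squarePair_nonneg i (x :: t)
      omega
    · have := ht.cyclicLength_gen_add_inv_of_ne hij
      have := pairSum_squarePair_nonneg i (x :: t)
      have := pairSum_squarePair_nonneg j (x :: t)
      omega

/-! ### Equality cases: runs and turns -/

/-- After `K` shifts an exponent initially bounded by `K` is zero or has the sign of its slope, so
another shift strictly enlarges it unless the slope vanishes. Hence the length stalls only if all
slopes vanish. -/
theorem length_syllWord_shift_mono (i : Fin 2) (K : ℕ) (ε : Bool) (s : List (ℤ × Bool))
    (hs : ∀ p ∈ s, |p.1| ≤ K) :
    (syllWord i (shift K ε s)).length ≤ (syllWord i (shift (K + 1) ε s)).length ∧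
      ((syllWord i (shift (K + 1) ε s)).length ≤ (syllWord i (shift K ε s)).length →
        shift 1 ε s = s) := by
  induction s generalizing ε with
  | nil => simp [shift]
  | cons p s ih =>
    obtain ⟨k, ε'⟩ := p
    have h1 := abs_le.1 (hs (k, ε') (by simp))
    have h2 := ih ε' fun p hp => hs p (mem_cons_of_mem _ hp)
    zify at h2 ⊢
    simp only [shift, length_syllWord_cons]
    have h3 : slope ε ε' = 0 ∨
        |k + K * slope ε ε'| < |k + (K + 1) * slope ε ε'| := by
      have e0 : |k + K| = k + K := abs_of_nonneg (by omega)
      have e1 : |k + (K + 1)| = k + (K + 1) := abs_of_nonneg (by omega)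
      have e2 : |k + -(K : ℤ)| = -(k + -(K : ℤ)) := abs_of_nonpos (by omega)
      have e3 : |k + (-1 + -(K : ℤ))| = -(k + (-1 + -(K : ℤ))) := abs_of_nonpos (by omega)
      cases ε <;> cases ε' <;> simp [slope, e0, e1, e2, e3]
    rcases h3 with h3 | h3
    · simp only [h3, mul_zero, add_zero, cons.injEq, true_and]
      exact ⟨by omega, fun h => h2.2 (by omega)⟩
    · exact ⟨by omega, fun h => by omega⟩

/-- If all exponents of a syllable word are bounded by `K` and the cyclic length does not increase
at the step `K + 1`, then the generator acts trivially on the cyclic word. -/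
theorem Closed.isConj_gen_of_syllWord {i : Fin 2} {ε : Bool} {s : List (ℤ × Bool)}
    (h : Closed (i, ε) (syllWord i s)) {K : ℕ} (hs : ∀ p ∈ s, |p.1| ≤ K)
    (hK : F2.cyclicLength ((gen i ^ (K + 1)) (.mk (syllWord i s))) ≤
      F2.cyclicLength ((gen i ^ K) (.mk (syllWord i s)))) :
    IsConj (gen i (.mk (syllWord i s))) (.mk (syllWord i s)) := by
  have e : ∀ n : ℕ, F2.cyclicLength ((gen i ^ n) (.mk (syllWord i s))) =
      (syllWord i (F2.shift n ε s)).length := by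
    intro n
    rw [← (h.shift n).cyclicLength, ← cyclicLength_eq_of_isConj (h.isConj_gen_zpow n),
      zpow_natCast]
  rw [e, e] at hK
  have h1 := (length_syllWord_shift_mono i K ε s hs).2 (by exact_mod_cast hK)
  have h2 := h.isConj_gen_zpow 1
  rwa [h1, zpow_one] at h2

theorem abs_le_length_syllWord (i : Fin 2) (s : List (ℤ × Bool)) :
    ∀ p ∈ s, |p.1| ≤ (syllWord i s).length := by
  induction s with
  | nil => simp
  | cons q s ih =>
    intro p hp
    rw [length_syllWord_cons]
    have := abs_nonneg q.1
    rcases mem_cons.1 hp with rfl | hp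
    · omega
    · have := ih p hp
      omega

/-- A long run of a generator along which the cyclic length does not finally increase is trivial. -/
theorem isConj_gen_of_run {i : Fin 2} {v : F2} {K : ℕ} (hv : cyclicLength v ≤ K)
    (hK : cyclicLength ((gen i ^ (K + 1)) v) ≤ cyclicLength ((gen i ^ K) v)) :
    IsConj (gen i v) v := by
  by_cases h1 : IsConj v 1
  · exact (isConj_map_one _ h1).trans h1.symm
  obtain ⟨x, t, ht, hc⟩ := exists_closed h1
  rcases ht.forall_or_exists_syllWord i with h0 | ⟨ε, s, hs, hconj, hlen, -⟩
  · have := gen_zpow_eq_self (fun y hy => h0 y (mem_cons_of_mem _ hy)) 1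
    rw [zpow_one] at this
    exact (this ▸ isConj_map (gen i) hc).trans hc.symm
  · have hc' := hc.trans hconj
    rw [cyclicLength_eq_of_isConj hc', hs.cyclicLength] at hv
    rw [cyclicLength_eq_of_isConj (isConj_map _ hc'),
      cyclicLength_eq_of_isConj (isConj_map _ hc')] at hK
    have := hs.isConj_gen_of_syllWord
      (fun p hp => (abs_le_length_syllWord i s p hp).trans (by exact_mod_cast hv)) hK
    exact ((isConj_map _ hc').trans this).trans hc'.symm

/-- A nonzero power `x^k` contains `|k| - 1` squares. -/
theorem abs_le_one_of_pairSum (i : Fin 2) (ε : Bool) (s : List (ℤ × Bool))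
    (h : pairSum (squarePair (i + 1)) ((i, ε) :: syllWord i s) = 0) : ∀ p ∈ s, |p.1| ≤ 1 := by
  have hi : i ≠ i + 1 := by fin_cases i <;> decide
  induction s generalizing ε with
  | nil => simp
  | cons q s ih =>
    obtain ⟨k, ε'⟩ := q
    rw [pairSum_syllWord_cons] at h
    have h1 := pairSum_squarePair_nonneg (i + 1) ((i, ε') :: syllWord i s)
    have h2 : |k| - 1 ≤ gapSum i (squarePair (i + 1)) ε k ε' ∧
        0 ≤ gapSum i (squarePair (i + 1)) ε k ε' := by
      rcases eq_or_ne k 0 with rfl | hk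
      · simp [gapSum, squarePair, hi]
      · have := abs_pos.2 hk
        simp [gapSum, squarePair, hi, hi.symm, hk]
        omega
    intro p hp
    rcases mem_cons.1 hp with rfl | hp
    · simp only; omega
    · exact ih ε' (by omega) p hp

/-- Without squares of the other letter all exponents are at most 1 in absolute value, so the run
criterion applies with `K = 1`. -/
theorem Closed.isConj_gen_of_pairSum {x : Letter} {t : List Letter} (h : Closed x t) {i : Fin 2}
    (h0 : pairSum (squarePair (i + 1)) (x :: t) = 0)
    (hK : F2.cyclicLength (gen i (gen i (.mk t))) ≤ F2.cyclicLength (gen i (.mk t))) :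
    IsConj (gen i (.mk t)) (.mk t) := by
  rcases h.forall_or_exists_syllWord i with h1 | ⟨ε, s, hs, hc, -, hsum⟩
  · have := gen_zpow_eq_self (fun y hy => h1 y (mem_cons_of_mem _ hy)) 1
    rw [zpow_one] at this
    rw [this]
  · rw [hsum] at h0
    rw [cyclicLength_eq_of_isConj (isConj_map _ (isConj_map _ hc)),
      cyclicLength_eq_of_isConj (isConj_map _ hc)] at hK
    have := hs.isConj_gen_of_syllWord (K := 1) (abs_le_one_of_pairSum i ε s h0)
      (by simpa [pow_succ] using hK)
    exact ((isConj_map _ hc).trans this).trans hc.symm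

/-- If the cyclic length is constant along `v, gen i v, gen j (gen i v), gen z (gen j (gen i v))`
with `i ≠ j`, then the middle step is trivial. -/
theorem isConj_gen_of_turn {i j : Fin 2} (hij : i ≠ j) (z : Fin 2) {u v : F2} (hu : gen i u = v)
    (h1 : cyclicLength v = cyclicLength u) (h2 : cyclicLength (gen j v) = cyclicLength v)
    (h3 : cyclicLength (gen z (gen j v)) = cyclicLength v) : IsConj (gen j v) v := by
  by_cases hv : IsConj v 1
  · exact (isConj_map_one _ hv).trans hv.symm
  obtain ⟨x, t, ht, hc⟩ := exists_closed hv
  have hji : j + 1 = i := (by decide : ∀ i j : Fin 2, i ≠ j → j + 1 = i) i j hij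
  have e1 : cyclicLength u = cyclicLength ((gen i)⁻¹ (.mk t)) := by
    rw [← cyclicLength_eq_of_isConj (isConj_map _ hc), ← hu, MulAut.inv_apply_self]
  -- Equality in convexity at `v` makes both square counts vanish; only this one is needed.
  have hsq : pairSum (squarePair i) (x :: t) = 0 := by
    have a1 := ht.cyclicLength_gen_add_inv_of_ne hij
    have a2 := pairSum_squarePair_nonneg i (x :: t)
    have a3 := pairSum_squarePair_nonneg j (x :: t)
    rw [← e1, ← h1, ← cyclicLength_eq_of_isConj (isConj_map _ hc), h2,
      ← ht.cyclicLength, ← cyclicLength_eq_of_isConj hc] at a1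
    omega
  have hgg : cyclicLength (gen j (gen j v)) = cyclicLength (gen j v) := by
    by_cases hz : z = j
    · subst hz; rw [h3, h2]
    obtain rfl : z = i :=
      (by decide : ∀ i j z : Fin 2, i ≠ j → ¬ z = j → z = i) i j z hij hz
    by_cases hgv : IsConj (gen j v) 1
    · exact cyclicLength_eq_of_isConj ((isConj_map_one _ hgv).trans hgv.symm)
    obtain ⟨x', t', ht', hc'⟩ := exists_closed hgv
    have e2 : cyclicLength v = cyclicLength ((gen j)⁻¹ (.mk t')) := by
      rw [← cyclicLength_eq_of_isConj (isConj_map _ hc'), MulAut.inv_apply_self]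
    -- The actual next step turns back to `i`, but equality there excludes squares at `gen j v`. The
    -- same-generator identity then shows that a hypothetical second step by `gen j` also preserves
    -- length.
    have a1 := ht'.cyclicLength_gen_add_inv_of_ne hij.symm
    have a2 := pairSum_squarePair_nonneg z (x' :: t')
    have a3 := pairSum_squarePair_nonneg j (x' :: t')
    have a4 := ht'.cyclicLength_gen_add_inv_same j
    rw [← e2, ← cyclicLength_eq_of_isConj (isConj_map _ hc'),
      ← ht'.cyclicLength, ← cyclicLength_eq_of_isConj hc'] at a1 a4
    omega
  have := ht.isConj_gen_of_pairSum (i := j) (hji ▸ hsq) (by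
    rw [← cyclicLength_eq_of_isConj (isConj_map _ (isConj_map _ hc)),
      ← cyclicLength_eq_of_isConj (isConj_map _ hc), hgg])
  exact ((isConj_map _ hc).trans this).trans hc.symm

/-! ### Chains as lists of generators -/

/-- The composition of the generators of a list, the first entry acting first. -/
def act : List (Fin 2) → MulAut F2
  | [] => 1
  | i :: w => act w * gen i

theorem act_append (w₁ w₂ : List (Fin 2)) : act (w₁ ++ w₂) = act w₂ * act w₁ := by
  induction w₁ with
  | nil => simp [act]
  | cons i w ih => rw [cons_append, act, ih, act, mul_assoc]

theorem act_replicate (n : ℕ) (i : Fin 2) : act (replicate n i) = gen i ^ n := by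
  induction n with
  | zero => rfl
  | succ n ih => rw [replicate_succ, act, ih, pow_succ]

/-- The list of generators of a chain, in the order in which they act. -/
def ChainC1.letters : ChainC1 → List (Fin 2)
  | [] => []
  | (l, m) :: c => replicate l 0 ++ (replicate m 1 ++ letters c)

theorem ChainC1.length_letters (c : ChainC1) : c.letters.length = c.len := by
  induction c with
  | nil => rfl
  | cons p c ih =>
    simp only [letters, length_append, length_replicate, ih, len, map_cons, sum_cons]
    omega

theorem ChainC1.act_letters (c : ChainC1) : act c.letters = c.toAut := by
  induction c with
  | nil => rfl
  | cons p c ih =>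
    rw [letters, act_append, act_append, act_replicate, act_replicate, ih, toAut, mul_assoc]
    rfl

/-- Each generator becomes a block of its own, the other exponent being zero. -/
theorem exists_chain (w : List (Fin 2)) :
    ∃ d : ChainC1, d.len = w.length ∧ d.toAut = act w := by
  induction w with
  | nil => exact ⟨[], rfl, rfl⟩
  | cons i w ih =>
    obtain ⟨d, h1, h2⟩ := ih
    fin_cases i
    · refine ⟨(1, 0) :: d, ?_, ?_⟩
      · simp only [ChainC1.len, map_cons, sum_cons, length_cons] at h1 ⊢
        omega
      · simp [ChainC1.toAut, act, h2, gen]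
    · refine ⟨(0, 1) :: d, ?_, ?_⟩
      · simp only [ChainC1.len, map_cons, sum_cons, length_cons] at h1 ⊢
        omega
      · simp [ChainC1.toAut, act, h2, gen]

/-! ### The plateau and the deletion of a step -/

/-- A convex sequence of natural numbers with equal end values at most `L` is constant away from
the `L` first and the `L` last steps. -/
theorem eq_of_convex {f : ℕ → ℕ} {n L : ℕ} (hf : ∀ t, t + 2 ≤ n → 2 * f (t + 1) ≤ f (t + 2) + f t)
    (h0 : f 0 ≤ L) (hn : f n = f 0) {t : ℕ} (hL : L ≤ t) (ht : t + L ≤ n) :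
    f t = f L ∧ f t ≤ L := by
  -- Increments are nondecreasing, stated without subtraction.
  have mono : ∀ s d, s + d < n → f (s + 1) + f (s + d) ≤ f (s + d + 1) + f s := by
    intro s d
    induction d with
    | zero => intro; simp
    | succ d ih =>
      intro h
      have h1 := ih (by omega)
      have h2 := hf (s + d) (by omega)
      simp only [← add_assoc] at *
      have : s + d + 1 + 1 = s + d + 2 := rfl
      rw [this]
      omega
  -- A descent at step `t ≥ L` would make all earlier steps descents, more than `f 0 ≤ L` permits.
  have inc : ∀ t, L ≤ t → t < n → f t ≤ f (t + 1) := by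
    intro t hL ht
    by_contra hc
    have : ∀ s, s ≤ t + 1 → f s + s ≤ f 0 := by
      intro s
      induction s with
      | zero => simp
      | succ s ih =>
        intro hs
        have h1 := ih (by omega)
        have h2 := mono s (t - s) (by omega)
        rw [show s + (t - s) = t by omega] at h2
        omega
    have := this (t + 1) le_rfl
    omega
  -- An ascent here would persist to the end and force `f n > L`.
  have dec : ∀ t, t + L < n → f (t + 1) ≤ f t := by
    intro t ht
    by_contra hc
    have : ∀ d, t + 1 + d ≤ n → d + 1 ≤ f (t + 1 + d) := by
      intro d
      induction d with
      | zero => intro; simp; omega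
      | succ d ih =>
        intro hd
        have h1 := ih (by omega)
        have h2 := mono t (d + 1) (by omega)
        rw [show t + (d + 1) = t + 1 + d by omega] at h2
        rw [← add_assoc]
        omega
    have := this (n - t - 1) (by omega)
    rw [show t + 1 + (n - t - 1) = n by omega] at this
    omega
  have le : ∀ t, t + L ≤ n → f t ≤ L := by
    intro t
    induction t with
    | zero => intro; exact h0
    | succ t ih =>
      intro h
      exact (dec t (by omega)).trans (ih (by omega))
  refine ⟨?_, le t ht⟩
  induction t, hL using Nat.le_induction with
  | base => rfl
  | succ t hL ih =>
    have h1 := inc t hL (by omega)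
    have h2 := dec t (by omega)
    have h3 := ih (by omega)
    omega

theorem act_take_succ (w : List (Fin 2)) {t : ℕ} (ht : t < w.length) (v : F2) :
    act (w.take (t + 1)) v = gen w[t] (act (w.take t) v) := by
  rw [take_succ_eq_append_getElem ht, act_append]
  simp [act]

/-- A step of a list of generators that is trivial on a family of cyclic words can be removed. -/
theorem exists_shorter {ι : Type*} {w : List (Fin 2)} {t : ℕ} (ht : t < w.length) {u : ι → F2}
    (h : ∀ i, IsConj (gen w[t] (act (w.take t) (u i))) (act (w.take t) (u i))) :
    ∃ w' : List (Fin 2), w'.length < w.length ∧ ∀ i, IsConj (act w' (u i)) (act w (u i)) := by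
  refine ⟨w.take t ++ w.drop (t + 1), ?_, fun i => ?_⟩
  · simp; omega
  · have e : act w = act (w.drop (t + 1)) * act (w.take (t + 1)) := by
      rw [← act_append, take_append_drop]
    rw [e, act_append, MulAut.mul_apply, MulAut.mul_apply, act_take_succ w ht]
    exact isConj_map _ (h i).symm

theorem exists_shorter_of_length {ι : Type*} {w : List (Fin 2)} {u : ι → F2} {L : ℕ}
    (hL : ∀ i, cyclicLength (u i) ≤ L) (hw : 4 * L + 5 ≤ w.length)
    (hfix : ∀ i, cyclicLength (act w (u i)) = cyclicLength (u i)) :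
    ∃ w' : List (Fin 2), w'.length < w.length ∧ ∀ i, IsConj (act w' (u i)) (act w (u i)) := by
  have const : ∀ i t, L ≤ t → t + L ≤ w.length →
      cyclicLength (act (w.take t) (u i)) = cyclicLength (act (w.take L) (u i)) ∧
        cyclicLength (act (w.take t) (u i)) ≤ L := by
    intro i t h1 h2
    refine eq_of_convex (f := fun t => cyclicLength (act (w.take t) (u i))) (n := w.length)
      (fun t ht => ?_) ?_ ?_ h1 h2
    · rw [act_take_succ w (t := t + 1) (by omega), act_take_succ w (t := t) (by omega)]
      exact two_mul_cyclicLength_le _ _ _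
    · simpa [act] using hL i
    · simpa [act] using hfix i
  -- The bound `t + 3 + L` keeps all four words needed for a turn on the plateau.
  by_cases hturn : ∃ t, ∃ h : t + 3 + L ≤ w.length, L ≤ t ∧
      w[t]'(by omega) ≠ w[t + 1]'(by omega)
  · obtain ⟨t, h, hLt, hne⟩ := hturn
    refine exists_shorter (t := t + 1) (by omega) fun i => ?_
    have c0 := (const i t hLt (by omega)).1
    have c1 := (const i (t + 1) (by omega) (by omega)).1
    have c2 := (const i (t + 2) (by omega) (by omega)).1
    have c3 := (const i (t + 3) (by omega) (by omega)).1
    have s0 := act_take_succ w (t := t) (by omega) (u i)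
    have s1 := act_take_succ w (t := t + 1) (by omega) (u i)
    have s2 := act_take_succ w (t := t + 2) (by omega) (u i)
    refine isConj_gen_of_turn hne w[t + 2] s0.symm (c1.trans c0.symm) ?_ ?_
    · rw [← s1]; exact c2.trans c1.symm
    · rw [← s1, ← s2]; exact c3.trans c1.symm
  -- Without a turn, positions `L` to `2 * L` carry the same generator: a run of `L + 1` steps
  -- starting from cyclic length at most `L`.
  · push Not at hturn
    have run : ∀ s, (hs : s ≤ L) → w[L + s]'(by omega) = w[L]'(by omega) := by
      intro s
      induction s with
      | zero => intro; rfl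
      | succ s ih =>
        intro hs
        rw [← ih (by omega)]
        exact (hturn (L + s) (by omega) (by omega)).symm
    have hpow : ∀ i s, s ≤ L + 1 →
        act (w.take (L + s)) (u i) = (gen (w[L]'(by omega)) ^ s) (act (w.take L) (u i)) := by
      intro i s
      induction s with
      | zero => intro; rfl
      | succ s ih =>
        intro hs
        rw [← add_assoc, act_take_succ w (by omega), ih (by omega), run s (by omega), pow_succ']
        rfl
    refine exists_shorter (t := L) (by omega) fun i => ?_
    refine isConj_gen_of_run (const i L le_rfl (by omega)).2 ?_
    rw [← hpow i _ le_rfl, ← hpow i _ (by omega)]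
    exact ((const i _ (by omega) (by omega)).1.trans
      (const i _ (by omega) (by omega)).1.symm).le

end F2

theorem mainTheorem5 (k : ℕ) (u : Fin k → F2)
    (φ : MulAut F2) (c : F2.ChainC1) (hφ : F2.CyclicEquiv φ (F2.ChainC1.toAut c))
    (hlen : 4 * F2.genLength u + 5 ≤ F2.ChainC1.len c)
    (hfix : ∀ i, F2.cyclicLength (φ (u i)) = F2.cyclicLength (u i)) :
    ∃ d : F2.ChainC1, F2.ChainC1.len d < F2.ChainC1.len c ∧
      ∀ i, F2.cyclicWord (F2.ChainC1.toAut d (u i)) = F2.cyclicWord (φ (u i)) := by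
  have hL : ∀ i, F2.cyclicLength (u i) ≤ F2.genLength u := fun i =>
    (F2.cyclicLength_le_wordLength (u i)).trans
      (Finset.le_sup (f := fun i => F2.wordLength (u i)) (Finset.mem_univ i))
  obtain ⟨w, hw, hconj⟩ := F2.exists_shorter_of_length (w := c.letters) hL
    (by rwa [c.length_letters]) (fun i => by
      rw [c.act_letters, ← hfix i, F2.cyclicLength, F2.cyclicLength, hφ (u i)])
  obtain ⟨d, hd, hact⟩ := F2.exists_chain w
  refine ⟨d, by rwa [hd, ← c.length_letters], fun i => ?_⟩
  rw [hact, F2.cyclicWord_eq_of_isConj (hconj i), c.act_letters, hφ (u i)]
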